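/- Let $G$ be a finite group. For subsets $A,B\subseteq G$ write $G=A\cdot B$ if every $x\in G$ can be written as $x=ab$ for exactly one pair $(a,b)\in A\times B$. A subset $A\subseteq G$ is a \emph{left factor} (respectively \emph{right factor}) of $G$ if there is $B\subseteq G$ with $G=A\cdot B$ (respectively $G=B\cdot A$); it is a \emph{factor} if it is a left or a right factor, and a \emph{two-sided factor} if it is both. It is a \emph{Lagrange subset} of $G$ if $|A|$ divides $|G|$. The group $G$ has the \emph{strong CFS property} if every Lagrange subset of $G$ is a factor of $G$. Then the following statements are equivalent: \begin{itemize} \item $G$ has the strong CFS property; \item every Lagrange subset of $G$ is a left factor of $G$; \item every Lagrange subset of $G$ is a right factor of $G$; \item every Lagrange subset of $G$ is a two-sided factor of $G$; \item for every Lagrange subset $A$ of $G$ there exists $B\subseteq G$ such that $G=A\cdot B=B\cdot A$; \item $G$ is isomorphic to the trivial group, to a cyclic group of prime order, or to one of the groups $C_2^2$, $C_4$, $C_2^3$, $C_3^2$, where $C_n$ denotes the cyclic group of order $n$. \end{itemize} In particular, if $G$ is nonabelian, then it satisfies none of these conditions. -/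

import Mathlib

/-- `A` is a Lagrange subset of the finite group `G`: its cardinality divides `|G|`. -/
def IsLagrangeSubset {G : Type*} [Group G] (A : Set G) : Prop :=
  A.ncard ∣ Nat.card G

/-- `A` is a left factor of `G`: there is `B ⊆ G` with `G = A · B`. Here
`Subgroup.IsComplement A B`, for arbitrary subsets `A` and `B`, is Mathlib's way to say that every
element of `G` is `a * b` for exactly one pair `(a, b) ∈ A × B`. -/
def IsLeftFactor {G : Type*} [Group G] (A : Set G) : Prop :=
  ∃ B : Set G, Subgroup.IsComplement A B

/-- `A` is a right factor of `G`: there is `B ⊆ G` with `G = B · A`. -/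
def IsRightFactor {G : Type*} [Group G] (A : Set G) : Prop :=
  ∃ B : Set G, Subgroup.IsComplement B A

/-- `A` is a factor of `G`: it is a left or a right factor. -/
def IsFactor {G : Type*} [Group G] (A : Set G) : Prop :=
  IsLeftFactor A ∨ IsRightFactor A

/-- `A` is a two-sided factor of `G`: it is a left and a right factor. -/
def IsTwoSidedFactor {G : Type*} [Group G] (A : Set G) : Prop :=
  IsLeftFactor A ∧ IsRightFactor A

/-- The strong CFS property of a finite group: every Lagrange subset is a factor. -/
def HasStrongCFS (G : Type*) [Group G] : Prop :=
  ∀ A : Set G, IsLagrangeSubset A → IsFactor A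

/-- The cyclic group of order `n` (for `n ≥ 1`), written multiplicatively. -/
abbrev Cyc (n : ℕ) : Type := Multiplicative (ZMod n)

/-- `G` is, up to isomorphism, one of: the trivial group; a cyclic group of prime order;
`C₂²`, `C₄`, `C₂³`, `C₃²`. -/
def IsStrongCFSListed (G : Type*) [Group G] : Prop :=
  Subsingleton G ∨
  (∃ p : ℕ, p.Prime ∧ Nonempty (G ≃* Cyc p)) ∨
  Nonempty (G ≃* (Fin 2 → Cyc 2)) ∨
  Nonempty (G ≃* Cyc 4) ∨
  Nonempty (G ≃* (Fin 3 → Cyc 2)) ∨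
  Nonempty (G ≃* (Fin 2 → Cyc 3))

/-!
For a nontrivial group with the strong CFS property, the list is reached by shrinking.

*Passage to subgroups.* If `A` lies in a subgroup `H` and `G = A · B`, then `H = A · (B ∩ H)`. Hence
the property is inherited by subgroups, and a divisor `d` of `|G|` with `d ≤ |H|` divides `|H|`
(`HasStrongCFS.dvd_card_of_le`). Applied to a subgroup whose order is a prime `p` and to a prime
`q < p`, this shows that `G` is a `p`-group, which has subgroups of every order dividing `|G|`. It
remains to exclude orders `p²` with `p ≥ 5`, order `9` unless `x³ = 1` holds, order `8` unless
`x² = 1` holds, and orders `16` and `27`.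

*Modified subgroups.* Every excluding subset has the form `A = (K \ U) ∪ X` with `K` a subgroup, `U`
a subset of less than half its size, and `X` disjoint from `K` with `|X| = |U|`.
For orders `8`, `16`, `27`, the subgroup `K` has index `2` or `3`, and `U`, `X` have one or two
elements, chosen so that both `A⁻¹A` and `AA⁻¹` are the whole group, which leaves no room for a
complement with more than one element (`not_hasStrongCFS_of_diff_union_pair`).
For orders `p²` and `9`, the subgroup `K` has prime order. A complement `B` of `A` is then also a
complement of `K`, and `X B ⊆ U B`; the choices `U = {1, h}`, `X = {x, h²x}`, respectively `U = {1}`,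
`X = {x}` with `x` of order `9`, contradict this (`not_hasStrongCFS_of_five_le_orderOf`,
`HasStrongCFS.pow_three_eq_one_of_card_eq_nine`).

Conversely, in a listed group a Lagrange subset of size other than `1` and `|G|` is a coset of a
subgroup of order two, or has so few quotients that some element `h` of order `|G| / |A|` is missed;
then `⟨h⟩` is a complement (`isLeftFactor_of_isStrongCFSListed`). For groups of prime order no such
size occurs. Since listed groups are commutative, complements are two-sided.
-/

/-! ### Complements of subsets -/

section Complement

variable {G : Type*} [Group G]

/-- In a finite group, injectivity of the product map and a cardinality count suffice for a
factorization. -/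
lemma isComplement_of_injective_of_ncard [Finite G] {A B : Set G}
    (h : ∀ a ∈ A, ∀ a' ∈ A, ∀ b ∈ B, ∀ b' ∈ B, a * b = a' * b' → a = a')
    (hcard : A.ncard * B.ncard = Nat.card G) : Subgroup.IsComplement A B := by
  have inj : Function.Injective (fun x : A × B ↦ (x.1 * x.2 : G)) := by
    rintro ⟨⟨a, ha⟩, ⟨b, hb⟩⟩ ⟨⟨a', ha'⟩, ⟨b', hb'⟩⟩ hab
    have hab : a * b = a' * b' := hab
    obtain rfl := h a ha a' ha' b hb b' hb' hab
    obtain rfl := mul_left_cancel hab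
    rfl
  refine (Nat.bijective_iff_injective_and_card _).2 ⟨inj, ?_⟩
  rw [Nat.card_prod, ← hcard]
  rfl

lemma Subgroup.IsComplement.ncard_mul_ncard {A B : Set G} (h : Subgroup.IsComplement A B) :
    A.ncard * B.ncard = Nat.card G :=
  h.card_mul_card

lemma Subgroup.IsComplement.eq_and_eq {A B : Set G} (h : Subgroup.IsComplement A B)
    {a a' b b' : G} (ha : a ∈ A) (ha' : a' ∈ A) (hb : b ∈ B) (hb' : b' ∈ B)
    (hab : a * b = a' * b') : a = a' ∧ b = b' := by
  have := @Function.Bijective.injective _ _ _ h (⟨a, ha⟩, ⟨b, hb⟩) (⟨a', ha'⟩, ⟨b', hb'⟩) hab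
  simpa using this

lemma Subgroup.IsComplement.exists_mul_eq {A B : Set G} (h : Subgroup.IsComplement A B) (g : G) :
    ∃ a ∈ A, ∃ b ∈ B, a * b = g := by
  obtain ⟨⟨⟨a, ha⟩, ⟨b, hb⟩⟩, hab⟩ := Function.Bijective.surjective h g
  exact ⟨a, ha, b, hb, hab⟩

lemma Subgroup.IsComplement.swap_of_comm {A B : Set G} (hG : ∀ x y : G, x * y = y * x)
    (h : Subgroup.IsComplement A B) : Subgroup.IsComplement B A := by
  have := h.comp (Equiv.prodComm B A).bijective
  refine (congrArg Function.Bijective (funext fun x ↦ ?_)).mp this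
  exact hG _ _

lemma isLeftFactor_of_isFactor_of_comm (hG : ∀ x y : G, x * y = y * x) {A : Set G}
    (h : IsFactor A) : IsLeftFactor A :=
  h.elim id fun ⟨B, hB⟩ ↦ ⟨B, hB.swap_of_comm hG⟩

end Complement

/-! ### Elementary abelian groups and the list -/

lemma nonempty_addEquiv_pi_zmod {V : Type*} [AddCommGroup V] [Finite V] {p n : ℕ}
    [Fact p.Prime] [Module (ZMod p) V] (hcard : Nat.card V = p ^ n) :
    Nonempty (V ≃+ (Fin n → ZMod p)) := by
  have h := Module.natCard_eq_pow_finrank (K := ZMod p) (V := V)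
  rw [Nat.card_zmod] at h
  have hfr : Module.finrank (ZMod p) V = n :=
    Nat.pow_right_injective (Fact.out : p.Prime).two_le (h.symm.trans hcard)
  exact ⟨(LinearEquiv.ofFinrankEq (R := ZMod p) V (Fin n → ZMod p) (by simpa using hfr)).toAddEquiv⟩

/-- A commutative group of order `p ^ n` and exponent dividing `p` is a vector space of dimension
`n` over `ZMod p`. -/
lemma nonempty_mulEquiv_pi_cyc {G : Type*} [CommGroup G] [Finite G]
    {p n : ℕ} [Fact p.Prime] (hp : ∀ x : G, x ^ p = 1) (hcard : Nat.card G = p ^ n) :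
    Nonempty (G ≃* (Fin n → Cyc p)) := by
  have : Finite (Additive G) := ‹Finite G›
  let _ : Module (ZMod p) (Additive G) := AddCommGroup.zmodModule fun x ↦ hp x.toMul
  obtain ⟨e⟩ := nonempty_addEquiv_pi_zmod (V := Additive G) hcard
  exact ⟨{ toFun := fun g i ↦ Multiplicative.ofAdd (e (Additive.ofMul g) i)
           invFun := fun f ↦ (e.symm fun i ↦ (f i).toAdd).toMul
           left_inv := fun g ↦ by simp
           right_inv := fun f ↦ by funext i; simp
           map_mul' := fun a b ↦ by funext i; simp }⟩

lemma mul_comm_of_forall_sq_eq_one {G : Type*} [Group G] (h : ∀ x : G, x ^ 2 = 1) (x y : G) :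
    x * y = y * x := by
  have hi : ∀ z : G, z⁻¹ = z := fun z ↦ inv_eq_of_mul_eq_one_right (by rw [← sq, h])
  calc x * y = (x * y)⁻¹ := (hi _).symm
    _ = y * x := by rw [mul_inv_rev, hi, hi]

lemma mul_comm_of_isStrongCFSListed {G : Type*} [Group G] (h : IsStrongCFSListed G) (x y : G) :
    x * y = y * x := by
  have key : ∀ {H : Type} [CommGroup H], Nonempty (G ≃* H) → x * y = y * x := by
    rintro H _ ⟨e⟩
    exact e.injective (by rw [map_mul, map_mul, mul_comm])
  rcases h with h | ⟨p, -, h⟩ | h | h | h | h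
  · exact Subsingleton.elim _ _
  all_goals exact key h

/-- The list of groups, described by order and exponent. -/
lemma isStrongCFSListed_iff (G : Type*) [Group G] [Finite G] :
    IsStrongCFSListed G ↔ Nat.card G = 1 ∨ (Nat.card G).Prime ∨ Nat.card G = 4 ∨
      (Nat.card G = 8 ∧ ∀ x : G, x ^ 2 = 1) ∨ (Nat.card G = 9 ∧ ∀ x : G, x ^ 3 = 1) := by
  have card_pi : ∀ n p : ℕ, Nat.card (Fin n → Cyc p) = p ^ n := fun n p ↦ by
    rw [Nat.card_fun, Nat.card_fin]
    exact congrArg (· ^ n) (Nat.card_zmod p)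
  have pow_pi : ∀ {n p : ℕ} (f : Fin n → Cyc p), f ^ p = 1 := fun {n p} f ↦ by
    funext i
    exact Multiplicative.toAdd.injective (by simp)
  constructor
  · rintro (h | ⟨p, hp, ⟨e⟩⟩ | ⟨⟨e⟩⟩ | ⟨⟨e⟩⟩ | ⟨⟨e⟩⟩ | ⟨⟨e⟩⟩)
    · exact .inl (Nat.card_eq_one_iff_unique.2 ⟨h, ⟨1⟩⟩)
    · refine .inr (.inl ?_)
      rw [Nat.card_congr e.toEquiv]
      exact (Nat.card_zmod p).symm ▸ hp
    · refine .inr (.inr (.inl ?_))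
      rw [Nat.card_congr e.toEquiv, card_pi]; norm_num
    · refine .inr (.inr (.inl ?_))
      rw [Nat.card_congr e.toEquiv]
      exact Nat.card_zmod 4
    · refine .inr (.inr (.inr (.inl ⟨?_, fun x ↦ e.injective ?_⟩)))
      · rw [Nat.card_congr e.toEquiv, card_pi]; norm_num
      · rw [map_pow, map_one, pow_pi]
    · refine .inr (.inr (.inr (.inr ⟨?_, fun x ↦ e.injective ?_⟩)))
      · rw [Nat.card_congr e.toEquiv, card_pi]; norm_num
      · rw [map_pow, map_one, pow_pi]
  · rintro (h | h | h | ⟨h, hx⟩ | ⟨h, hx⟩)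
    · exact .inl (Nat.card_eq_one_iff_unique.1 h).1
    · have := Fact.mk h
      have : IsCyclic G := isCyclic_of_prime_card rfl
      exact .inr (.inl ⟨_, h, ⟨(zmodCyclicMulEquiv this).symm⟩⟩)
    · by_cases hx : ∀ x : G, x ^ 2 = 1
      · let _ : CommGroup G :=
          { ‹Group G› with mul_comm := mul_comm_of_forall_sq_eq_one hx }
        exact .inr (.inr (.inl (nonempty_mulEquiv_pi_cyc hx (by rw [h]; norm_num))))
      · push Not at hx
        obtain ⟨x, hx⟩ := hx
        have hord : orderOf x = 4 := by
          have h4 : orderOf x ∣ 2 ^ (1 + 1) := by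
            have := orderOf_dvd_natCard x
            rwa [h] at this
          exact orderOf_eq_prime_pow (p := 2) (n := 1) (by simpa using hx)
            (orderOf_dvd_iff_pow_eq_one.1 h4)
        have : IsCyclic G := isCyclic_of_orderOf_eq_card x (by rw [hord, h])
        have e := zmodCyclicMulEquiv this
        rw [h] at e
        exact .inr (.inr (.inr (.inl ⟨e.symm⟩)))
    · let _ : CommGroup G := { ‹Group G› with mul_comm := mul_comm_of_forall_sq_eq_one hx }
      exact .inr (.inr (.inr (.inr (.inl (nonempty_mulEquiv_pi_cyc hx (by rw [h]; norm_num))))))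
    · have hc := (IsPGroup.isMulCommutative_of_card_eq_prime_sq (G := G) (p := 3)
        (by rw [h]; norm_num)).is_comm.comm
      let _ : CommGroup G := { ‹Group G› with mul_comm := hc }
      exact .inr (.inr (.inr (.inr (.inr (nonempty_mulEquiv_pi_cyc hx (by rw [h]; norm_num))))))

/-! ### Factorizations in the listed groups -/

section Listed

variable {G : Type*} [Group G] [Finite G]

/-- A transversal of `H` of the right size, detected by quotients, has `H` as a complement. -/
lemma isComplement_subgroup_of_ncard (A : Set G) (H : Subgroup G)
    (hA : ∀ a ∈ A, ∀ a' ∈ A, a⁻¹ * a' ∈ H → a = a') (hcard : A.ncard * Nat.card H = Nat.card G) :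
    Subgroup.IsComplement A H := by
  refine isComplement_of_injective_of_ncard (fun a ha a' ha' b hb b' hb' hab ↦ ?_) hcard
  refine hA a ha a' ha' ?_
  have : a⁻¹ * a' = b * b'⁻¹ := by
    rw [eq_mul_inv_iff_mul_eq, mul_assoc, ← hab, inv_mul_cancel_left]
  rw [this]
  exact H.mul_mem hb (H.inv_mem hb')

/-- If `(a⁻¹ b)² = 1`, then `{a, b}` is a coset of a subgroup, and any transversal of that subgroup
is a complement. -/
lemma isLeftFactor_pair_of_sq_eq_one {a b : G} (hab : a ≠ b) (h : (a⁻¹ * b) ^ 2 = 1) :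
    IsLeftFactor ({a, b} : Set G) := by
  obtain ⟨S, hS, -⟩ := Subgroup.exists_isComplement_right (Subgroup.zpowers (a⁻¹ * b)) 1
  have hne : a⁻¹ * b ≠ 1 := fun h ↦ hab (inv_mul_eq_one.1 h)
  have hcardH : Nat.card (Subgroup.zpowers (a⁻¹ * b)) = 2 := by
    rw [Nat.card_zpowers]
    exact orderOf_eq_prime h hne
  have hmem : ∀ c ∈ ({a, b} : Set G), a⁻¹ * c ∈ Subgroup.zpowers (a⁻¹ * b) := by
    rintro c (rfl | rfl)
    · simp
    · exact Subgroup.mem_zpowers _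
  refine ⟨S, isComplement_of_injective_of_ncard (fun c hc c' hc' s hs s' hs' hcs ↦ ?_) ?_⟩
  · have := hS.eq_and_eq (hmem c hc) (hmem c' hc') hs hs'
      (by rw [mul_assoc, hcs, mul_assoc])
    exact mul_left_cancel this.1
  · rw [Set.ncard_pair hab, ← hS.ncard_mul_ncard, ← hcardH]
    rfl

lemma eq_of_mem_zpowers_of_orderOf_le_three {h c : G} (hh : orderOf h ≤ 3)
    (hc : c ∈ Subgroup.zpowers h) : c = 1 ∨ c = h ∨ c = h⁻¹ := by
  classical
  rw [mem_zpowers_iff_mem_range_orderOf, Finset.mem_image] at hc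
  obtain ⟨k, hk, rfl⟩ := hc
  rw [Finset.mem_range] at hk
  have hk3 : k < 3 := by omega
  interval_cases k
  · exact .inl (pow_zero h)
  · exact .inr (.inl (pow_one h))
  · have : orderOf h = 3 := by omega
    refine .inr (.inr (eq_inv_of_mul_eq_one_left ?_))
    rw [← pow_succ]
    exact orderOf_dvd_iff_pow_eq_one.1 this.dvd

/-- For `p ∈ {2, 3}`, a set of size `|G| / p` is a left factor as soon as its quotients miss an
element of order `p`: the subgroup generated by that element is a complement. -/
lemma isLeftFactor_of_missed_quotient {A : Set G} {h : G} (hh : orderOf h = 2 ∨ orderOf h = 3)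
    (hcard : A.ncard * orderOf h = Nat.card G) (hA : ∀ a ∈ A, ∀ a' ∈ A, a⁻¹ * a' ≠ h) :
    IsLeftFactor A := by
  refine ⟨_, isComplement_subgroup_of_ncard A (Subgroup.zpowers h) ?_
    (by rwa [Nat.card_zpowers])⟩
  intro a ha a' ha' hmem
  by_contra hne
  have h1 : a⁻¹ * a' ≠ 1 := fun h ↦ hne (inv_mul_eq_one.1 h)
  have h2 : (a⁻¹ * a')⁻¹ ≠ h := by
    rw [mul_inv_rev, inv_inv]
    exact hA a' ha' a ha
  have h3 := hA a ha a' ha'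
  generalize a⁻¹ * a' = c at *
  rcases eq_of_mem_zpowers_of_orderOf_le_three (by omega) hmem with rfl | rfl | rfl
  · exact h1 rfl
  · exact h3 rfl
  · exact h2 (inv_inv _)

lemma isLeftFactor_pair_of_card_eq_four (hG : Nat.card G = 4) {a b : G} (hab : a ≠ b) :
    IsLeftFactor ({a, b} : Set G) := by
  by_cases hc : (a⁻¹ * b) ^ 2 = 1
  · exact isLeftFactor_pair_of_sq_eq_one hab hc
  -- Now `a⁻¹ b` has order `4`, and its square is the missed element of order `2`.
  set c := a⁻¹ * b with hcdef
  have hord : orderOf c = 4 := by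
    have h4 : orderOf c ∣ 2 ^ (1 + 1) := by
      have := orderOf_dvd_natCard c
      rwa [hG] at this
    exact orderOf_eq_prime_pow (p := 2) (n := 1) (by simpa using hc)
      (orderOf_dvd_iff_pow_eq_one.1 h4)
  have hord2 : orderOf (c ^ 2) = 2 := by
    rw [orderOf_pow, hord]; norm_num
  have hc4 : c ^ 4 = 1 := hord ▸ pow_orderOf_eq_one c
  refine isLeftFactor_of_missed_quotient (h := c ^ 2) (.inl hord2)
    (by rw [Set.ncard_pair hab, hord2, hG]) ?_
  have hc1 : c ≠ 1 := fun h ↦ hc (by rw [h, one_pow])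
  rintro x (rfl | rfl) y (rfl | rfl) hxy
  · rw [inv_mul_cancel] at hxy
    exact hc hxy.symm
  · change c = c ^ 2 at hxy
    exact hc1 (by simpa [sq] using hxy)
  · have : c⁻¹ = c ^ 2 := by rw [hcdef, mul_inv_rev, inv_inv]; exact hxy
    refine hc1 ?_
    have h3 : c ^ 3 = 1 := by rw [pow_succ, ← this, inv_mul_cancel]
    calc c = c ^ 4 * (c ^ 3)⁻¹ := by group
      _ = 1 := by rw [hc4, h3]; simp
  · rw [inv_mul_cancel] at hxy
    exact hc hxy.symm

lemma exists_notMem_of_card_lt {G : Type*} [Finite G] (D : Finset G) (h : D.card < Nat.card G) :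
    ∃ g, g ∉ D := by
  by_contra! hD
  have := Fintype.ofFinite G
  rw [Nat.card_eq_fintype_card, ← Finset.card_univ, ← Finset.eq_univ_iff_forall.2 hD] at h
  exact lt_irrefl _ h

/-- Every Lagrange subset of a listed group is a left factor. For the sizes other than `1` and
`|G|`, either the set is a coset of a subgroup of order two, or it has too few quotients to cover
the group. -/
lemma isLeftFactor_of_isStrongCFSListed (hG : IsStrongCFSListed G) {A : Set G}
    (hA : IsLagrangeSubset A) : IsLeftFactor A := by
  classical
  have hA : A.ncard ∣ Nat.card G := hA
  by_cases h1 : A.ncard = 1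
  · obtain ⟨a, rfl⟩ := Set.ncard_eq_one.1 h1
    exact ⟨_, Subgroup.isComplement_singleton_univ⟩
  by_cases h2 : A.ncard = Nat.card G
  · obtain rfl : A = Set.univ := Set.eq_univ_iff_ncard A |>.2 h2
    exact ⟨{1}, Subgroup.isComplement_univ_singleton⟩
  rcases (isStrongCFSListed_iff G).1 hG with h | h | h | ⟨h, hx⟩ | ⟨h, hx⟩
  · rw [h] at hA
    exact absurd (Nat.dvd_one.1 hA) h1
  · exact absurd ((Nat.dvd_prime h).1 hA) (by tauto)
  · have : A.ncard = 2 := by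
      rw [h] at hA h2
      have := Nat.le_of_dvd (by norm_num) hA
      interval_cases A.ncard <;> omega
    obtain ⟨a, b, hab, rfl⟩ := Set.ncard_eq_two.1 this
    exact isLeftFactor_pair_of_card_eq_four h hab
  · have : A.ncard = 2 ∨ A.ncard = 4 := by
      rw [h] at hA h2
      have := Nat.le_of_dvd (by norm_num) hA
      interval_cases A.ncard <;> omega
    rcases this with h3 | h3
    · obtain ⟨a, b, hab, rfl⟩ := Set.ncard_eq_two.1 h3
      exact isLeftFactor_pair_of_sq_eq_one hab (hx _)
    · obtain ⟨a, s, -, rfl, hs⟩ := Set.eq_insert_of_ncard_eq_succ h3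
      obtain ⟨b, c, d, -, -, -, rfl⟩ := Set.ncard_eq_three.1 hs
      have hi : ∀ z : G, z⁻¹ = z := fun z ↦ inv_eq_of_mul_eq_one_right (by rw [← sq, hx])
      have hcomm := mul_comm_of_forall_sq_eq_one hx
      -- The six products of two distinct elements and `1` do not exhaust the eight elements.
      obtain ⟨g, hg⟩ := exists_notMem_of_card_lt
        (insert (1 : G) {a * b, a * c, a * d, b * c, b * d, c * d}) (by
          rw [h]
          exact (Finset.card_insert_le _ _).trans_lt
            (Nat.lt_succ_of_le (Nat.succ_le_succ Finset.card_le_six)))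
      simp only [Finset.mem_insert, Finset.mem_singleton, not_or] at hg
      obtain ⟨g1, g2, g3, g4, g5, g6, g7⟩ := hg
      have hord : orderOf g = 2 := orderOf_eq_prime (hx g) g1
      refine isLeftFactor_of_missed_quotient (.inl hord) (by rw [h3, hord, h]) ?_
      have hself : ∀ z : G, z * z = 1 := fun z ↦ by rw [← sq, hx]
      rintro x hx' y hy' rfl
      rw [hi] at *
      simp only [Set.mem_insert_iff, Set.mem_singleton_iff] at hx' hy'
      rcases hx' with rfl | rfl | rfl | rfl <;> rcases hy' with rfl | rfl | rfl | rfl <;>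
        first
        | exact g1 (hself _) | exact g2 rfl | exact g3 rfl | exact g4 rfl | exact g5 rfl
        | exact g6 rfl | exact g7 rfl | exact g2 (hcomm _ _) | exact g3 (hcomm _ _)
        | exact g4 (hcomm _ _) | exact g5 (hcomm _ _) | exact g6 (hcomm _ _)
        | exact g7 (hcomm _ _)
  · have : A.ncard = 3 := by
      rw [h] at hA h2
      have := Nat.le_of_dvd (by norm_num) hA
      interval_cases A.ncard <;> omega
    have hcard3 := this
    obtain ⟨a, b, c, -, -, -, rfl⟩ := Set.ncard_eq_three.1 this
    -- The six quotients of two distinct elements and `1` do not exhaust the nine elements.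
    obtain ⟨g, hg⟩ := exists_notMem_of_card_lt
      (insert (1 : G) {a⁻¹ * b, a⁻¹ * c, b⁻¹ * a, b⁻¹ * c, c⁻¹ * a, c⁻¹ * b}) (by
        rw [h]
        exact (Finset.card_insert_le _ _).trans_lt
          ((Nat.succ_le_succ Finset.card_le_six).trans_lt (by norm_num)))
    simp only [Finset.mem_insert, Finset.mem_singleton, not_or] at hg
    obtain ⟨g1, g2, g3, g4, g5, g6, g7⟩ := hg
    have hord : orderOf g = 3 := orderOf_eq_prime (hx g) g1
    refine isLeftFactor_of_missed_quotient (.inr hord) (by rw [hcard3, hord, h]) ?_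
    rintro x hx' y hy' rfl
    simp only [Set.mem_insert_iff, Set.mem_singleton_iff] at hx' hy'
    rcases hx' with rfl | rfl | rfl <;> rcases hy' with rfl | rfl | rfl <;>
      first
      | exact g1 (inv_mul_cancel _) | exact g2 rfl | exact g3 rfl | exact g4 rfl | exact g5 rfl
      | exact g6 rfl | exact g7 rfl

end Listed

/-! ### Passage to subgroups -/

section Subgroups

variable {G : Type*} [Group G]

lemma isComplement_preimage_right {H : Subgroup G} {A : Set H} {B : Set G}
    (h : Subgroup.IsComplement ((↑) '' A : Set G) B) :
    Subgroup.IsComplement A ((↑) ⁻¹' B : Set H) := by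
  constructor
  · rintro ⟨⟨a, ha⟩, ⟨b, hb⟩⟩ ⟨⟨a', ha'⟩, ⟨b', hb'⟩⟩ hab
    have hab : a * b = a' * b' := hab
    obtain ⟨h1, h2⟩ := h.eq_and_eq (Set.mem_image_of_mem _ ha) (Set.mem_image_of_mem _ ha') hb hb'
      (congrArg Subtype.val hab)
    obtain rfl := Subtype.ext h1
    obtain rfl := Subtype.ext h2
    rfl
  · intro g
    obtain ⟨_, ⟨a, ha, rfl⟩, b, hb, hab⟩ := h.exists_mul_eq (g : G)
    have hbH : b ∈ H := by
      rw [← inv_mul_eq_iff_eq_mul.2 hab.symm]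
      exact H.mul_mem (H.inv_mem a.2) g.2
    exact ⟨(⟨a, ha⟩, ⟨⟨b, hbH⟩, hb⟩), Subtype.ext hab⟩

lemma isComplement_preimage_left {H : Subgroup G} {A : Set H} {B : Set G}
    (h : Subgroup.IsComplement B ((↑) '' A : Set G)) :
    Subgroup.IsComplement ((↑) ⁻¹' B : Set H) A := by
  constructor
  · rintro ⟨⟨b, hb⟩, ⟨a, ha⟩⟩ ⟨⟨b', hb'⟩, ⟨a', ha'⟩⟩ hab
    have hab : b * a = b' * a' := hab
    obtain ⟨h1, h2⟩ := h.eq_and_eq hb hb' (Set.mem_image_of_mem _ ha) (Set.mem_image_of_mem _ ha')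
      (congrArg Subtype.val hab)
    obtain rfl := Subtype.ext h1
    obtain rfl := Subtype.ext h2
    rfl
  · intro g
    obtain ⟨b, hb, _, ⟨a, ha, rfl⟩, hab⟩ := h.exists_mul_eq (g : G)
    have hbH : b ∈ H := by
      rw [← mul_inv_eq_iff_eq_mul.2 hab.symm]
      exact H.mul_mem g.2 (H.inv_mem a.2)
    exact ⟨(⟨⟨b, hbH⟩, hb⟩, ⟨a, ha⟩), Subtype.ext hab⟩

/-- A subset of a subgroup that is a factor of the whole group is a factor of the subgroup: intersect
the complement with the subgroup. -/
lemma IsFactor.of_image_subtype {H : Subgroup G} {A : Set H}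
    (h : IsFactor ((↑) '' A : Set G)) : IsFactor A := by
  rcases h with ⟨B, hB⟩ | ⟨B, hB⟩
  · exact .inl ⟨_, isComplement_preimage_right hB⟩
  · exact .inr ⟨_, isComplement_preimage_left hB⟩

lemma IsFactor.ncard_dvd {A : Set G} (h : IsFactor A) : A.ncard ∣ Nat.card G := by
  rcases h with ⟨B, hB⟩ | ⟨B, hB⟩
  · exact ⟨_, hB.ncard_mul_ncard.symm⟩
  · exact ⟨_, by rw [mul_comm, hB.ncard_mul_ncard]⟩

lemma HasStrongCFS.subgroup (h : HasStrongCFS G) (H : Subgroup G) : HasStrongCFS H := by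
  intro A hA
  refine .of_image_subtype (h _ ?_)
  rw [IsLagrangeSubset, Set.ncard_image_of_injective _ Subtype.val_injective]
  exact dvd_trans hA H.card_subgroup_dvd_card

/-- Under the strong CFS property, a divisor of `|G|` that is at most `|H|` divides `|H|`, since it
is the size of a subset of `H`. -/
lemma HasStrongCFS.dvd_card_of_le [Finite G] (h : HasStrongCFS G) (H : Subgroup G) {d : ℕ}
    (hd : d ∣ Nat.card G) (hle : d ≤ Nat.card H) : d ∣ Nat.card H := by
  obtain ⟨A, -, hA⟩ := Set.exists_subset_card_eq (s := (Set.univ : Set H)) (n := d)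
    (by rwa [Set.ncard_univ])
  rw [← hA]
  refine (IsFactor.of_image_subtype (h _ ?_)).ncard_dvd
  rw [IsLagrangeSubset, Set.ncard_image_of_injective _ Subtype.val_injective, hA]
  exact hd

/-- Two distinct primes `q < p` cannot both divide `|G|`: a subgroup of order `p` has room for a
subset of size `q`. -/
lemma HasStrongCFS.card_eq_prime_pow [Finite G] (h : HasStrongCFS G) (hG : Nat.card G ≠ 1) :
    ∃ p n : ℕ, p.Prime ∧ Nat.card G = p ^ n := by
  have key : ∀ p q : ℕ, p.Prime → q.Prime → p ∣ Nat.card G → q ∣ Nat.card G → q ≤ p → q = p := by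
    intro p q hp hq hpG hqG hle
    have := Fact.mk hp
    obtain ⟨x, hx⟩ := exists_prime_orderOf_dvd_card' p hpG
    have hcard : Nat.card (Subgroup.zpowers x) = p := by rw [Nat.card_zpowers, hx]
    have := h.dvd_card_of_le (Subgroup.zpowers x) hqG (by rwa [hcard])
    rw [hcard] at this
    exact (Nat.prime_dvd_prime_iff_eq hq hp).1 this
  refine ⟨_, _, Nat.minFac_prime hG,
    Nat.eq_prime_pow_of_unique_prime_dvd Nat.card_pos.ne' fun {d} hd hdG ↦ ?_⟩
  exact (key d _ hd (Nat.minFac_prime hG) hdG (Nat.minFac_dvd _)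
    (Nat.minFac_le_of_dvd hd.two_le hdG)).symm

end Subgroups

/-! ### Modified subgroups: the sets `(K \ U) ∪ X` -/

section Modified

variable {G : Type*} [Group G] [Finite G]

lemma IsLagrangeSubset.of_ncard_eq {G : Type*} [Group G] {K : Subgroup G} {A : Set G}
    (h : A.ncard = Nat.card K) : IsLagrangeSubset A := by
  rw [IsLagrangeSubset, h]
  exact K.card_subgroup_dvd_card

lemma ncard_diff_union (K : Subgroup G) {U X : Set G} (hU : U ⊆ K) (hX : Disjoint (K : Set G) X)
    (hUX : U.ncard = X.ncard) : ((K : Set G) \ U ∪ X).ncard = Nat.card K := by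
  have h1 := Set.ncard_sdiff_add_ncard_of_subset hU (Set.toFinite (K : Set G))
  have h2 : (K : Set G).ncard = Nat.card K := rfl
  rw [Set.ncard_union_eq (hX.mono_left Set.sdiff_subset)]
  omega

/-- Since `U` fills less than half of `K`, an injective self-map of `K` sends some element outside
`U` to an element outside `U`. -/
lemma exists_mem_diff_map_mem_diff (K : Subgroup G) {U : Set G} (hcard : 2 * U.ncard < Nat.card K)
    {f : G → G} (hf : Function.Injective f) (hfK : ∀ a ∈ K, f a ∈ K) :
    ∃ a ∈ (K : Set G) \ U, f a ∈ (K : Set G) \ U := by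
  by_contra! hcon
  have hsub : (K : Set G) ⊆ U ∪ f ⁻¹' U := by
    intro a ha
    by_contra ha'
    rw [Set.mem_union, not_or] at ha'
    exact hcon a ⟨ha, ha'.1⟩ ⟨hfK a ha, ha'.2⟩
  have h1 := (Set.ncard_le_ncard hsub).trans (Set.ncard_union_le _ _)
  have h2 : (f ⁻¹' U).ncard ≤ U.ncard :=
    Set.ncard_le_ncard_of_injOn f (fun a ha ↦ ha) hf.injOn
  have h3 : (K : Set G).ncard = Nat.card K := rfl
  omega

/-- If the quotients of `A` on both sides cover `G`, then a complement of `A` on either side has a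
single element. -/
lemma not_isFactor_of_quotients {A : Set G} (hA : A.ncard < Nat.card G)
    (h1 : ∀ g : G, ∃ a ∈ A, ∃ b ∈ A, a⁻¹ * b = g) (h2 : ∀ g : G, ∃ a ∈ A, ∃ b ∈ A, a * b⁻¹ = g) :
    ¬ IsFactor A := by
  have key : ∀ B : Set G, (∀ b ∈ B, ∀ b' ∈ B, b = b') → A.ncard * B.ncard ≠ Nat.card G := by
    intro B hB hcard
    have : B.ncard ≤ 1 := (Set.ncard_le_one (Set.toFinite B)).2 hB
    nlinarith
  rintro (⟨B, hB⟩ | ⟨B, hB⟩)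
  · refine key B (fun b hb b' hb' ↦ ?_) hB.ncard_mul_ncard
    obtain ⟨a, ha, a', ha', h⟩ := h1 (b * b'⁻¹)
    refine (hB.eq_and_eq ha ha' hb hb' ?_).2
    rw [inv_mul_eq_iff_eq_mul] at h
    rw [h]; group
  · refine key B (fun b hb b' hb' ↦ ?_) (by rw [mul_comm, hB.ncard_mul_ncard])
    obtain ⟨a, ha, a', ha', h⟩ := h2 (b⁻¹ * b')
    refine (hB.eq_and_eq hb hb' ha ha' ?_).1
    rw [mul_inv_eq_iff_eq_mul] at h
    rw [h]; group

/-- Let `G / K` be generated by the class of `x` and have at most three elements. Replacing the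
elements of a small `U ⊆ K` by `x` and `y ∈ x⁻¹K` yields a set of size `|K|` whose quotients cover
`G`. Indeed `g ∈ xK` is `(x g⁻¹)⁻¹ x` and also `y⁻¹ (y g)`; both fail only if `x g⁻¹` and `y g` lie
in `U`, and then `y ∈ U x⁻¹ U`. -/
lemma not_hasStrongCFS_of_diff_union_pair {K : Subgroup G} [K.Normal] {U : Set G} (hU : U ⊆ K)
    {x y : G} (hcard : 2 * U.ncard < Nat.card K) (hUX : U.ncard = ({x, y} : Set G).ncard)
    (hx : x ∉ K) (hxy : x * y ∈ K) (hcoset : ∀ g ∉ K, x⁻¹ * g ∈ K ∨ x * g ∈ K)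
    (hy : ∀ u ∈ U, ∀ v ∈ U, y ≠ u * x⁻¹ * v) : ¬ HasStrongCFS G := by
  intro hG
  have hN : ∀ a b : G, a * b ∈ K → b * a ∈ K := fun a b h ↦
    (Subgroup.Normal.mem_comm_iff ‹K.Normal›).1 h
  have hyK : y ∉ K := fun h ↦ hx ((K.mul_mem_cancel_right h).1 hxy)
  set A : Set G := (K : Set G) \ U ∪ {x, y} with hA
  have hxA : x ∈ A := .inr (.inl rfl)
  have hyA : y ∈ A := .inr (.inr rfl)
  have hcardA : A.ncard = Nat.card K := by
    refine ncard_diff_union K hU (Set.disjoint_right.2 ?_) hUX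
    rintro z (rfl | rfl)
    · exact hx
    · exact hyK
  have hlt : Nat.card K < Nat.card G := by
    refine lt_of_le_of_ne (Nat.le_of_dvd Nat.card_pos K.card_subgroup_dvd_card) fun h ↦ hx ?_
    rw [Subgroup.eq_top_of_card_eq K h]
    exact Subgroup.mem_top x
  have hleft : ∀ g, x⁻¹ * g ∈ K → ∃ a ∈ A, ∃ b ∈ A, a⁻¹ * b = g := by
    intro g hg
    have h1 : x * g⁻¹ ∈ K := by
      have := K.inv_mem (hN _ _ hg)
      rwa [mul_inv_rev, inv_inv] at this
    have h2 : y * g ∈ K := by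
      have := K.mul_mem (hN _ _ hxy) hg
      rwa [mul_assoc, mul_inv_cancel_left] at this
    by_cases hu : x * g⁻¹ ∈ U
    · by_cases hv : y * g ∈ U
      · exact absurd (by group) (hy _ hv _ hu)
      · exact ⟨y, hyA, y * g, .inl ⟨h2, hv⟩, by group⟩
    · exact ⟨x * g⁻¹, .inl ⟨h1, hu⟩, x, hxA, by group⟩
  have hright : ∀ g, x⁻¹ * g ∈ K → ∃ a ∈ A, ∃ b ∈ A, a * b⁻¹ = g := by
    intro g hg
    have h1 : g⁻¹ * x ∈ K := by
      have := K.inv_mem hg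
      rwa [mul_inv_rev, inv_inv] at this
    have h2 : g * y ∈ K := by
      have := K.mul_mem (hN _ _ hg) hxy
      rwa [mul_assoc, inv_mul_cancel_left] at this
    by_cases hu : g⁻¹ * x ∈ U
    · by_cases hv : g * y ∈ U
      · exact absurd (by group) (hy _ hu _ hv)
      · exact ⟨g * y, .inl ⟨h2, hv⟩, y, hyA, by group⟩
    · exact ⟨x, hxA, g⁻¹ * x, .inl ⟨h1, hu⟩, by group⟩
  have hinv : ∀ g, x * g ∈ K → x⁻¹ * g⁻¹ ∈ K := by
    intro g hg
    have := K.inv_mem (hN _ _ hg)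
    rwa [mul_inv_rev] at this
  refine not_isFactor_of_quotients (hcardA.trans_lt hlt) (fun g ↦ ?_) (fun g ↦ ?_)
    (hG A (.of_ncard_eq hcardA))
  · by_cases hgK : g ∈ K
    · obtain ⟨a, ha, hb⟩ := exists_mem_diff_map_mem_diff K hcard (mul_left_injective g)
        (fun a ha ↦ K.mul_mem ha hgK)
      exact ⟨a, .inl ha, a * g, .inl hb, by group⟩
    · rcases hcoset g hgK with h | h
      · exact hleft g h
      · obtain ⟨a, ha, b, hb, hab⟩ := hleft g⁻¹ (hinv g h)
        exact ⟨b, hb, a, ha, by rw [← inv_inv g, ← hab]; group⟩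
  · by_cases hgK : g ∈ K
    · obtain ⟨a, ha, hb⟩ := exists_mem_diff_map_mem_diff K hcard (mul_right_injective g)
        (fun a ha ↦ K.mul_mem hgK ha)
      exact ⟨g * a, .inl hb, a, .inl ha, by group⟩
    · rcases hcoset g hgK with h | h
      · exact hright g h
      · obtain ⟨a, ha, b, hb, hab⟩ := hright g⁻¹ (hinv g h)
        exact ⟨b, hb, a, ha, by rw [← inv_inv g, ← hab]; group⟩

lemma inv_mul_mem_or_mul_mem_of_index {K : Subgroup G} [K.Normal] (hK : K.index = 2 ∨ K.index = 3)
    {x : G} (hx : x ∉ K) {g : G} (hg : g ∉ K) : x⁻¹ * g ∈ K ∨ x * g ∈ K := by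
  have hp : Fact (Nat.card (G ⧸ K)).Prime := ⟨by
    change K.index.Prime
    rcases hK with h | h <;> rw [h] <;> norm_num⟩
  have hle : orderOf (x : G ⧸ K) ≤ 3 := by
    refine (Nat.le_of_dvd Nat.card_pos (orderOf_dvd_natCard _)).trans ?_
    change K.index ≤ 3
    omega
  have hmem : (g : G ⧸ K) ∈ Subgroup.zpowers (x : G ⧸ K) :=
    mem_zpowers_of_prime_card rfl (fun h ↦ hx ((QuotientGroup.eq_one_iff x).1 h))
  rcases eq_of_mem_zpowers_of_orderOf_le_three hle hmem with h | h | h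
  · exact absurd ((QuotientGroup.eq_one_iff g).1 h) hg
  · exact .inl (QuotientGroup.eq.1 h.symm)
  · refine .inr ?_
    rw [← QuotientGroup.eq_one_iff, QuotientGroup.mk_mul, h, mul_inv_cancel]

lemma exists_notMem_of_index {G : Type*} [Group G] {K : Subgroup G} (hK : K.index = 2 ∨ K.index = 3) :
    ∃ x, x ∉ K := by
  by_contra! h
  rw [(Subgroup.eq_top_iff' K).2 h, Subgroup.index_top] at hK
  omega

/-- Take `U = {1, u}`: the conditions on `y ∈ x⁻¹K` exclude at most five elements. -/
lemma not_hasStrongCFS_of_index_of_six_le_card {K : Subgroup G} [K.Normal]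
    (hK : K.index = 2 ∨ K.index = 3) (hcard : 6 ≤ Nat.card K) : ¬ HasStrongCFS G := by
  classical
  obtain ⟨x, hx⟩ := exists_notMem_of_index hK
  have : Nontrivial K := (Finite.one_lt_card_iff_nontrivial).1 (by omega)
  obtain ⟨u, huK, hu⟩ := K.nontrivial_iff_exists_ne_one.1 this
  let D : Finset G :=
    {x * x, x * 1 * x⁻¹ * 1, x * 1 * x⁻¹ * u, x * u * x⁻¹ * 1, x * u * x⁻¹ * u}
  obtain ⟨k, hkK, hk⟩ := Set.exists_mem_notMem_of_ncard_lt_ncard (s := (D : Set G))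
    (t := (K : Set G)) (by
      rw [Set.ncard_coe_finset]
      exact lt_of_le_of_lt Finset.card_le_five hcard)
  simp only [D, Finset.coe_insert, Finset.coe_singleton, Set.mem_insert_iff,
    Set.mem_singleton_iff, not_or] at hk
  obtain ⟨k1, k2, k3, k4, k5⟩ := hk
  have hne : x ≠ x⁻¹ * k := fun h ↦ k1 (by rw [eq_inv_mul_iff_mul_eq] at h; exact h.symm)
  refine not_hasStrongCFS_of_diff_union_pair (U := {1, u}) (x := x) (y := x⁻¹ * k) ?_ ?_ ?_ hx
    (by rwa [mul_inv_cancel_left]) (fun g hg ↦ inv_mul_mem_or_mul_mem_of_index hK hx hg) ?_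
  · rintro z (rfl | rfl)
    · exact K.one_mem
    · exact huK
  · rw [Set.ncard_pair hu.symm]; omega
  · rw [Set.ncard_pair hu.symm, Set.ncard_pair hne]
  · rintro v (rfl | rfl) w (rfl | rfl) h <;>
      rw [inv_mul_eq_iff_eq_mul, ← mul_assoc, ← mul_assoc] at h
    · exact k2 h
    · exact k3 h
    · exact k4 h
    · exact k5 h

/-- A group of order `8` with an element `r` of order greater than `2` has a subgroup `K` of order
`4` missing such an element. If a first choice of `K` fails, then `K` contains `r` and every
`x ∉ K` inverts `K`, so that the centralizer of `x` is a second choice. -/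
lemma exists_subgroup_card_four_notMem (hG : Nat.card G = 8) {r : G} (hr : r ^ 2 ≠ 1) :
    ∃ K : Subgroup G, Nat.card K = 4 ∧ ∃ x ∉ K, x ^ 2 ≠ 1 := by
  have := Fact.mk Nat.prime_two
  obtain ⟨K, hK⟩ := Sylow.exists_subgroup_card_pow_prime (G := G) 2 (n := 2)
    (by rw [hG]; norm_num)
  have hK : Nat.card K = 4 := hK
  by_contra! hcon
  have hrK : r ∈ K := by
    by_contra h
    exact hr (hcon K hK r h)
  have hr4 : r ^ 4 = 1 := by
    have h := pow_card_eq_one' (x := (⟨r, hrK⟩ : K))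
    rw [hK] at h
    exact congrArg Subtype.val h
  have hindex : K.index = 2 := by
    have := K.card_mul_index
    rw [hK, hG] at this
    omega
  obtain ⟨x, hx⟩ := exists_notMem_of_index (.inl hindex)
  have hx2 : x * x = 1 := by rw [← sq, hcon K hK x hx]
  have hinv : ∀ k ∈ K, x * k * (x * k) = 1 := fun k hk ↦ by
    rw [← sq]
    exact hcon K hK _ fun h ↦ hx ((K.mul_mem_cancel_right hk).1 h)
  let C := Subgroup.centralizer {x}
  have hxC : x ∈ C := Subgroup.mem_centralizer_singleton_iff.2 rfl
  have hr2C : r ^ 2 ∈ C := by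
    refine Subgroup.mem_centralizer_singleton_iff.2 ?_
    have h1 := hinv (r ^ 2) (K.pow_mem hrK 2)
    have h2 : r ^ 2 * r ^ 2 = 1 := by rw [← pow_add, hr4]
    calc r ^ 2 * x = (x * x) * (r ^ 2 * x) * (r ^ 2 * r ^ 2) := by rw [hx2, h2]; simp
      _ = x * (x * r ^ 2 * (x * r ^ 2)) * r ^ 2 := by simp only [mul_assoc]
      _ = x * r ^ 2 := by rw [h1, mul_one]
  have hrC : r ∉ C := fun h ↦ by
    have h1 : r * x = x * r := Subgroup.mem_centralizer_singleton_iff.1 h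
    have h2 := hinv r hrK
    refine hr ?_
    calc r ^ 2 = (x * x) * (r * r) := by rw [hx2, one_mul, sq]
      _ = x * (x * r) * r := by simp only [mul_assoc]
      _ = x * (r * x) * r := by rw [h1]
      _ = x * r * (x * r) := by simp only [mul_assoc]
      _ = 1 := h2
  have hC : Nat.card C = 4 := by
    have hdvd : Nat.card C ∣ 8 := hG ▸ C.card_subgroup_dvd_card
    have h3 : 3 ≤ Nat.card C := by
      have hsub : ({1, x, r ^ 2} : Set G) ⊆ C := by
        rintro z (rfl | rfl | rfl)
        · exact C.one_mem
        · exact hxC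
        · exact hr2C
      have h := Set.ncard_le_ncard hsub
      rw [Set.ncard_eq_three.2 ⟨1, x, r ^ 2, fun h ↦ hx (h ▸ K.one_mem), hr.symm,
        fun h ↦ hx (h ▸ K.pow_mem hrK 2), rfl⟩] at h
      exact h
    have h8 : Nat.card C ≠ 8 := fun h ↦ hrC (by
      rw [Subgroup.eq_top_of_card_eq C (h.trans hG.symm)]
      exact Subgroup.mem_top r)
    have := Nat.le_of_dvd (by norm_num) hdvd
    interval_cases Nat.card C <;> omega
  exact hr (hcon C hC r hrC)

lemma HasStrongCFS.sq_eq_one_of_card_eq_eight (h : HasStrongCFS G) (hG : Nat.card G = 8) (r : G) :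
    r ^ 2 = 1 := by
  by_contra hr
  obtain ⟨K, hK, x, hx, hx2⟩ := exists_subgroup_card_four_notMem hG hr
  have hindex : K.index = 2 := by
    have := K.card_mul_index
    rw [hK, hG] at this
    omega
  have := Subgroup.normal_of_index_eq_two hindex
  refine not_hasStrongCFS_of_diff_union_pair (K := K) (U := {1}) (x := x) (y := x) ?_ ?_ ?_ hx
    ?_ (fun g hg ↦ inv_mul_mem_or_mul_mem_of_index (.inl hindex) hx hg) ?_ h
  · simp
  · simp [hK]
  · simp
  · rw [← sq]
    exact hindex ▸ Subgroup.sq_mem_of_index_two hindex x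
  · rintro u rfl v rfl h
    refine hx2 ?_
    rw [one_mul, mul_one] at h
    rw [sq]
    exact mul_eq_one_iff_eq_inv.2 h

/-! ### Complements of modified subgroups -/

/-- If `U` is small, translates of `H \ U` within a coset of `H` overlap, so that a complement of
`(H \ U) ∪ X` is a transversal of `H`. -/
lemma isComplement_of_diff_union (H : Subgroup G) {U X B : Set G}
    (hcard : 2 * U.ncard < Nat.card H) (hA : ((H : Set G) \ U ∪ X).ncard = Nat.card H)
    (h : Subgroup.IsComplement ((H : Set G) \ U ∪ X) B) : Subgroup.IsComplement (H : Set G) B := by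
  refine isComplement_of_injective_of_ncard (fun a ha a' ha' b hb b' hb' hab ↦ ?_) ?_
  · obtain ⟨c, hc, hc'⟩ := exists_mem_diff_map_mem_diff H hcard
      (mul_left_injective (a'⁻¹ * a)) fun c hc ↦ H.mul_mem hc (H.mul_mem (H.inv_mem ha') ha)
    have := (h.eq_and_eq (.inl hc) (.inl hc') hb' hb (by
      rw [mul_assoc, mul_assoc, hab]; group)).2
    rw [this] at hab
    exact mul_right_cancel hab
  · rw [← h.ncard_mul_ncard, hA]
    rfl

/-- A complement `B` of `(H \ U) ∪ X` satisfies `X B ⊆ U B`. -/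
lemma exists_mul_eq_of_diff_union {G : Type*} [Group G] (H : Subgroup G) {U X B : Set G}
    (hX : Disjoint (H : Set G) X) (h : Subgroup.IsComplement ((H : Set G) \ U ∪ X) B)
    (hH : Subgroup.IsComplement (H : Set G) B) {x b : G} (hx : x ∈ X) (hb : b ∈ B) :
    ∃ u ∈ U, ∃ b' ∈ B, u * b' = x * b := by
  obtain ⟨a, ha, b', hb', hab⟩ := hH.exists_mul_eq (x * b)
  refine ⟨a, ?_, b', hb', hab⟩
  by_contra haU
  have := (h.eq_and_eq (.inl ⟨ha, haU⟩) (.inr hx) hb' hb hab).1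
  exact Set.disjoint_left.1 hX ha (this ▸ hx)

/-- For a subgroup `H = ⟨h⟩` of order at least `5` and `x ∉ H`, the set obtained from `H` by
replacing `1, h` by `x, h²x` has no complement: such a complement `B` would be a transversal of `H`,
and for `b ∈ B` the points `xb` and `h²xb` of one coset of `H` would be `{b', hb'}` for some
`b' ∈ B`, forcing `h² ∈ {1, h, h⁻¹}`. -/
lemma not_hasStrongCFS_of_five_le_orderOf (hG : ∀ a b : G, a * b = b * a) {h x : G}
    (hh : 5 ≤ orderOf h) (hx : x ∉ Subgroup.zpowers h) : ¬ HasStrongCFS G := by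
  intro hCFS
  have hpow : ∀ k : ℕ, 0 < k → k < 5 → h ^ k ≠ 1 := fun k hk hk' ↦
    pow_ne_one_of_lt_orderOf hk.ne' (by omega)
  have h1 : h ≠ 1 := fun e ↦ hpow 1 (by norm_num) (by norm_num) (by rw [e, one_pow])
  have h2 : h ^ 2 ≠ 1 := hpow 2 (by norm_num) (by norm_num)
  have h3 : h ^ 3 ≠ 1 := hpow 3 (by norm_num) (by norm_num)
  set H := Subgroup.zpowers h with hH
  have hhH : h ∈ H := Subgroup.mem_zpowers h
  have hU : ({1, h} : Set G) ⊆ H := by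
    rintro z (rfl | rfl)
    · exact H.one_mem
    · exact hhH
  have hX : Disjoint (H : Set G) {x, h ^ 2 * x} := by
    refine Set.disjoint_right.2 ?_
    rintro z (rfl | rfl)
    · exact hx
    · exact fun hz ↦ hx ((H.mul_mem_cancel_left (H.pow_mem hhH 2)).1 hz)
  have hcardU : ({1, h} : Set G).ncard = 2 := Set.ncard_pair h1.symm
  have hA := ncard_diff_union H hU hX (by
    rw [hcardU, Set.ncard_pair]
    exact fun e ↦ h2 (mul_eq_right.1 e.symm))
  obtain ⟨B, hB⟩ := isLeftFactor_of_isFactor_of_comm hG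
    (hCFS _ (.of_ncard_eq hA))
  have hHB := isComplement_of_diff_union H (by rw [hcardU, Nat.card_zpowers]; omega) hA hB
  obtain ⟨b, hb⟩ := hB.nonempty_right
  obtain ⟨u, hu, c, hc, huc⟩ := exists_mul_eq_of_diff_union H hX hB hHB (.inl rfl) hb
  obtain ⟨v, hv, d, hd, hvd⟩ := exists_mul_eq_of_diff_union H hX hB hHB (.inr rfl) hb
  have huv : h ^ 2 * u = v := (hHB.eq_and_eq (H.mul_mem (H.pow_mem hhH 2) (hU hu)) (hU hv) hc hd
    (by rw [mul_assoc, huc, hvd, mul_assoc])).1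
  rcases hu with rfl | rfl <;> rcases hv with rfl | rfl
  · exact h2 (by rwa [mul_one] at huv)
  · rw [mul_one, sq] at huv
    exact h1 (mul_eq_right.1 huv)
  · exact h3 (by rwa [← pow_succ] at huv)
  · exact h2 (mul_eq_right.1 huv)

/-- If `x` had order `9`, replace `1` by `x` in `H = ⟨x³⟩`. A complement `B` of the resulting set is
a transversal of `H` with `x B ⊆ B`, hence with `x³ B ⊆ B`, which is absurd as `x³ ∈ H`. -/
lemma HasStrongCFS.pow_three_eq_one_of_card_eq_nine (hCFS : HasStrongCFS G)
    (hcard : Nat.card G = 9) (x : G) : x ^ 3 = 1 := by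
  have := Fact.mk Nat.prime_three
  have hG := (IsPGroup.isMulCommutative_of_card_eq_prime_sq (G := G) (p := 3)
    (by rw [hcard]; norm_num)).is_comm.comm
  by_contra hx3
  have hord : orderOf x = 9 := by
    have h9 : orderOf x ∣ 3 ^ (1 + 1) := by
      have := orderOf_dvd_natCard x
      rwa [hcard] at this
    exact orderOf_eq_prime_pow (p := 3) (n := 1) (by simpa using hx3)
      (orderOf_dvd_iff_pow_eq_one.1 h9)
  set H := Subgroup.zpowers (x ^ 3) with hH
  have hcardH : Nat.card H = 3 := by
    rw [hH, Nat.card_zpowers, orderOf_pow, hord]; norm_num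
  have hx : x ∉ H := fun hx ↦ by
    have h := H.orderOf_dvd_natCard hx
    rw [hord, hcardH] at h
    omega
  have hX : Disjoint (H : Set G) {x} := Set.disjoint_singleton_right.2 hx
  have hA := ncard_diff_union H (U := {1}) (by simp) hX (by simp)
  obtain ⟨B, hB⟩ := isLeftFactor_of_isFactor_of_comm hG
    (hCFS _ (.of_ncard_eq hA))
  have hHB := isComplement_of_diff_union H (by rw [Set.ncard_singleton, hcardH]; omega) hA hB
  have hmul : ∀ b ∈ B, x * b ∈ B := by
    intro b hb
    obtain ⟨u, rfl, c, hc, huc⟩ := exists_mul_eq_of_diff_union H hX hB hHB rfl hb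
    rwa [← huc, one_mul]
  obtain ⟨b, hb⟩ := hB.nonempty_right
  have hmem : x ^ 3 * b ∈ B := by
    have := hmul _ (hmul _ (hmul _ hb))
    rwa [← mul_assoc, ← mul_assoc, ← pow_three'] at this
  exact hx3 (hHB.eq_and_eq (Subgroup.mem_zpowers _) H.one_mem hb hmem (one_mul _).symm).1

end Modified

/-! ### The classification -/

section Classification

variable {G : Type*} [Group G] [Finite G]

lemma not_hasStrongCFS_of_card_eq_prime_sq {p : ℕ} (hp : p.Prime) (hp5 : 5 ≤ p)
    (hcard : Nat.card G = p ^ 2) : ¬ HasStrongCFS G := by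
  have := Fact.mk hp
  have hG := (IsPGroup.isMulCommutative_of_card_eq_prime_sq hcard).is_comm.comm
  obtain ⟨h, hh⟩ := exists_prime_orderOf_dvd_card' (G := G) p
    (by rw [hcard]; exact dvd_pow_self p two_ne_zero)
  have hx : ∃ x, x ∉ Subgroup.zpowers h := by
    by_contra! hall
    have := Nat.card_zpowers h
    rw [(Subgroup.eq_top_iff' _).2 hall, Subgroup.card_top, hcard, hh] at this
    nlinarith
  obtain ⟨x, hx⟩ := hx
  exact not_hasStrongCFS_of_five_le_orderOf hG (hh ▸ hp5) hx

lemma not_hasStrongCFS_of_card_eq_pow {p n : ℕ} (hp : p = 2 ∨ p = 3) (hn : 6 ≤ p ^ n)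
    (hcard : Nat.card G = p ^ (n + 1)) : ¬ HasStrongCFS G := by
  have hprime : p.Prime := by rcases hp with rfl | rfl <;> norm_num
  have := Fact.mk hprime
  obtain ⟨K, hK⟩ := Sylow.exists_subgroup_card_pow_prime (G := G) p (n := n)
    (by rw [hcard, pow_succ]; exact dvd_mul_right _ _)
  have hindex : K.index = p := by
    have h := K.card_mul_index
    rw [hK, hcard, pow_succ] at h
    exact Nat.eq_of_mul_eq_mul_left (by omega) h
  have : K.Normal := Subgroup.normal_of_index_eq_minFac_card (by
    rw [hindex, hcard, Nat.pow_minFac n.succ_ne_zero, hprime.minFac_eq])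
  exact not_hasStrongCFS_of_index_of_six_le_card (hindex ▸ hp) (hK ▸ hn)

lemma isStrongCFSListed_of_hasStrongCFS (h : HasStrongCFS G) : IsStrongCFSListed G := by
  rw [isStrongCFSListed_iff]
  by_cases h1 : Nat.card G = 1
  · exact .inl h1
  obtain ⟨p, n, hp, hcard⟩ := h.card_eq_prime_pow h1
  have := Fact.mk hp
  -- The subgroups of `G` have all orders `p ^ k` with `k ≤ n`, and they inherit the property.
  have hsub : ∀ k ≤ n, ∃ K : Subgroup G, Nat.card K = p ^ k ∧ HasStrongCFS K := fun k hk ↦ by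
    obtain ⟨K, hK⟩ := Sylow.exists_subgroup_card_pow_prime (G := G) p (n := k)
      (hcard ▸ pow_dvd_pow p hk)
    exact ⟨K, hK, h.subgroup K⟩
  have hn0 : n ≠ 0 := by
    rintro rfl
    exact h1 (by rw [hcard, pow_zero])
  by_cases hn1 : n = 1
  · refine .inr (.inl ?_)
    rwa [hcard, hn1, pow_one]
  have hp5 : p < 5 := by
    by_contra hp5
    obtain ⟨K, hK, hK'⟩ := hsub 2 (by omega)
    exact not_hasStrongCFS_of_card_eq_prime_sq hp (by omega) hK hK'
  have hp23 : p = 2 ∨ p = 3 := by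
    have := hp.two_le
    interval_cases p
    · exact .inl rfl
    · exact .inr rfl
    · exact absurd hp (by norm_num)
  rcases hp23 with rfl | rfl
  · have hn : n < 4 := by
      by_contra hn
      obtain ⟨K, hK, hK'⟩ := hsub 4 (by omega)
      exact not_hasStrongCFS_of_card_eq_pow (n := 3) (.inl rfl) (by norm_num) hK hK'
    have hn : n = 2 ∨ n = 3 := by omega
    rcases hn with rfl | rfl
    · exact .inr (.inr (.inl hcard))
    · exact .inr (.inr (.inr (.inl ⟨hcard, h.sq_eq_one_of_card_eq_eight hcard⟩)))
  · have hn : n < 3 := by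
      by_contra hn
      obtain ⟨K, hK, hK'⟩ := hsub 3 (by omega)
      exact not_hasStrongCFS_of_card_eq_pow (n := 2) (.inr rfl) (by norm_num) hK hK'
    obtain rfl : n = 2 := by omega
    exact .inr (.inr (.inr (.inr ⟨hcard, h.pow_three_eq_one_of_card_eq_nine hcard⟩)))

end Classification

theorem mainTheorem2 (G : Type*) [Group G] [Finite G] :
    List.TFAE [
      HasStrongCFS G,
      ∀ A : Set G, IsLagrangeSubset A → IsLeftFactor A,
      ∀ A : Set G, IsLagrangeSubset A → IsRightFactor A,
      ∀ A : Set G, IsLagrangeSubset A → IsTwoSidedFactor A,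
      ∀ A : Set G, IsLagrangeSubset A →
        ∃ B : Set G, Subgroup.IsComplement A B ∧ Subgroup.IsComplement B A,
      IsStrongCFSListed G] ∧
    ((∃ x y : G, x * y ≠ y * x) →
      ¬ HasStrongCFS G ∧
      ¬ (∀ A : Set G, IsLagrangeSubset A → IsLeftFactor A) ∧
      ¬ (∀ A : Set G, IsLagrangeSubset A → IsRightFactor A) ∧
      ¬ (∀ A : Set G, IsLagrangeSubset A → IsTwoSidedFactor A) ∧
      ¬ (∀ A : Set G, IsLagrangeSubset A →
        ∃ B : Set G, Subgroup.IsComplement A B ∧ Subgroup.IsComplement B A) ∧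
      ¬ IsStrongCFSListed G) := by
  have h16 : HasStrongCFS G → IsStrongCFSListed G := isStrongCFSListed_of_hasStrongCFS
  have h65 : IsStrongCFSListed G → ∀ A : Set G, IsLagrangeSubset A →
      ∃ B : Set G, Subgroup.IsComplement A B ∧ Subgroup.IsComplement B A := fun h A hA ↦ by
    obtain ⟨B, hB⟩ := isLeftFactor_of_isStrongCFSListed h hA
    exact ⟨B, hB, hB.swap_of_comm (mul_comm_of_isStrongCFSListed h)⟩
  have h21 : (∀ A : Set G, IsLagrangeSubset A → IsLeftFactor A) → HasStrongCFS G :=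
    fun h A hA ↦ .inl (h A hA)
  have h31 : (∀ A : Set G, IsLagrangeSubset A → IsRightFactor A) → HasStrongCFS G :=
    fun h A hA ↦ .inr (h A hA)
  have h42 : (∀ A : Set G, IsLagrangeSubset A → IsTwoSidedFactor A) →
      ∀ A : Set G, IsLagrangeSubset A → IsLeftFactor A := fun h A hA ↦ (h A hA).1
  have h43 : (∀ A : Set G, IsLagrangeSubset A → IsTwoSidedFactor A) →
      ∀ A : Set G, IsLagrangeSubset A → IsRightFactor A := fun h A hA ↦ (h A hA).2
  have h54 : (∀ A : Set G, IsLagrangeSubset A →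
      ∃ B : Set G, Subgroup.IsComplement A B ∧ Subgroup.IsComplement B A) →
      ∀ A : Set G, IsLagrangeSubset A → IsTwoSidedFactor A := fun h A hA ↦ by
    obtain ⟨B, hB, hB'⟩ := h A hA
    exact ⟨⟨B, hB⟩, ⟨B, hB'⟩⟩
  refine ⟨?_, ?_⟩
  · tfae_have 1 → 6 := h16
    tfae_have 6 → 5 := h65
    tfae_have 5 → 4 := h54
    tfae_have 4 → 3 := h43
    tfae_have 4 → 2 := h42
    tfae_have 3 → 1 := h31
    tfae_have 2 → 1 := h21
    tfae_finish
  · rintro ⟨x, y, hxy⟩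
    have h6 : ¬ IsStrongCFSListed G := fun h ↦ hxy (mul_comm_of_isStrongCFSListed h x y)
    exact ⟨fun h ↦ h6 (h16 h), fun h ↦ h6 (h16 (h21 h)), fun h ↦ h6 (h16 (h31 h)),
      fun h ↦ h6 (h16 (h21 (h42 h))), fun h ↦ h6 (h16 (h21 (h42 (h54 h)))), h6⟩
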